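/- Let $n\ge 0$ be an integer and $\tau>0$. A \emph{cone} in $\mathbb R^n$ is a set containing $0$ and closed under addition and under multiplication by nonnegative scalars; it is \emph{polyhedral} if it is generated by finitely many vectors, and \emph{$\tau$-wide} if it contains a closed Euclidean ball of radius $\tau$ centered at a point of the unit sphere. A \emph{face} of a convex set $K$ is a convex subset $F\subseteq K$ such that whenever $x,y\in K$, $0<\lambda<1$ and $\lambda x+(1-\lambda)y\in F$, then $x,y\in F$. A finite set $\mathcal T=\{C_1,\dots,C_k\}$ of distinct closed cones in $\mathbb R^n$, each of dimension $n$, is a \emph{partition} of a closed cone $\Sigma$ if $C_1\cup\dots\cup C_k=\Sigma$ and for all $i\ne j$ the set $C_i\cap C_j$ is a face of both $C_i$ and $C_j$. Its boundary is $\partial\mathcal T=\bigcup_{i=1}^k\partial C_i$. A random vector $X\in\mathbb R^n$ is \emph{exponentially distributed on} $\Sigma$ if its law has density $c_\Sigma e^{-\|x\|}\mathbf 1_{x\in\Sigma}$ with respect to Lebesgue measure, where $\|\cdot\|$ is the Euclidean norm and $c_\Sigma^{-1}=\int_\Sigma e^{-\|x\|}\,dx$. Let $[a,b]$ denote the closed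 line segment from $a$ to $b$, and $|A|$ the number of elements of a set $A$ ($\infty$ if $A$ is infinite). Let $\mathcal T$ be a partition of a cone $\Sigma\subseteq\mathbb R^n$ into polyhedral $\tau$-wide cones, let $c,d\in\mathbb R^n$, and let $X$ be exponentially distributed on $\Sigma$. Then $|\partial\mathcal T\cap[c+X,d+X]|$ and, for each $\alpha\in(0,1)$, $|\partial\mathcal T\cap[c+\alpha X,c+X]|$ are (almost everywhere) measurable, and: (1) $\displaystyle \mathbb E\bigl[\,|\partial\mathcal T\cap[c+X,d+X]|\,\bigr]\le \frac{\|d-c\|}{\tau}$; (2) for every $\alpha\in(0,1)$, $\displaystyle \mathbb E\bigl[\,|\partial\mathcal T\cap[c+\alpha X,c+X]|\,\bigr]\le \frac{2n}{\tau}\ln\frac1\alpha$. -/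

import Mathlib

open MeasureTheory ProbabilityTheory
open scoped ENNReal

namespace ConePartition

variable {E : Type*} [NormedAddCommGroup E] [NormedSpace ℝ E]

/-- A cone (containing `0`, closed under addition and multiplication by nonnegative scalars) is
polyhedral if it is generated by finitely many vectors. -/
def IsPolyhedral (C : PointedCone ℝ E) : Prop :=
  ∃ Y : Finset E, PointedCone.hull ℝ (Y : Set E) = C

/-- A cone is `τ`-wide if it contains a ball of radius `τ` centered on the unit sphere. -/
def IsWide (τ : ℝ) (C : PointedCone ℝ E) : Prop :=
  ∃ u : E, ‖u‖ = 1 ∧ Metric.closedBall u τ ⊆ (C : Set E)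

/-- The finite set of cones `T` is a (full-dimensional) partition of the cone `S`: every cone in
`T` is closed and spans the space, any two distinct cones in `T` meet in a common face, and the
support of `T` is the closed cone `S`. -/
structure IsPartition (T : Finset (PointedCone ℝ E)) (S : PointedCone ℝ E) : Prop where
  isClosed_of_mem : ∀ C ∈ T, IsClosed (C : Set E)
  span_eq_top : ∀ C ∈ T, Submodule.span ℝ (C : Set E) = ⊤
  isExtreme_inter : ∀ C ∈ T, ∀ D ∈ T, C ≠ D →
    IsExtreme ℝ (C : Set E) ((C : Set E) ∩ (D : Set E)) ∧
      IsExtreme ℝ (D : Set E) ((C : Set E) ∩ (D : Set E))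
  support_eq : (⋃ C ∈ T, (C : Set E)) = (S : Set E)
  isClosed_support : IsClosed (S : Set E)

/-- The boundary of a finite set of cones: the union of the boundaries of its members. -/
def boundary (T : Finset (PointedCone ℝ E)) : Set E :=
  ⋃ C ∈ T, frontier (C : Set E)

/-- The number (possibly infinite) of points in which the closed segment `[a, b]` meets the
boundary of `T`, as an extended nonnegative real. -/
noncomputable def crossings (T : Finset (PointedCone ℝ E)) (a b : E) : ℝ≥0∞ :=
  ((boundary T ∩ segment ℝ a b).encard : ℝ≥0∞)

variable [MeasureSpace E]

/-- The normalizing constant `c_S`, the inverse of the integral of `exp (-‖x‖)` over `S`. -/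
noncomputable def expConst (S : PointedCone ℝ E) : ℝ≥0∞ :=
  (∫⁻ x in (S : Set E), ENNReal.ofReal (Real.exp (-‖x‖)))⁻¹

/-- The density `c_S * exp (-‖x‖)` on `S`, and `0` outside `S`. -/
noncomputable def expDensity (S : PointedCone ℝ E) : E → ℝ≥0∞ :=
  (S : Set E).indicator fun x => expConst S * ENNReal.ofReal (Real.exp (-‖x‖))

/-- The random vector `X` is exponentially distributed on the cone `S`. -/
def IsExpDistributed {Ω : Type*} [MeasurableSpace Ω] (P : Measure Ω) (S : PointedCone ℝ E)
    (X : Ω → E) : Prop :=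
  HasLaw X (volume.withDensity (expDensity S)) P

end ConePartition

namespace ConePartition

open Set Filter Topology

/-! Let `u` be the centre of the ball inside a cone `C` of the partition. Unless `C` is the whole
space, it is the epigraph in direction `u` of a height `H` (`exists_height`). The ball makes `H`
Lipschitz with constant `1/τ`, and `H` vanishes on the boundary of `C`. Crossings of the path `s ↦ x
+ p + s • v` with that boundary are therefore bounded by the zeros of `H` along it. Translating `x`
by `r • u` turns zeros into points at level `r`. Tonelli in direction `u` and the Banach indicatrix
inequality then bound the weighted number of crossings by an integral over `s` of the local slope
times the weight at the crossing (`lintegral_encard_height_zeros_mul_le`).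

That weight is charged to the interior of `C`: along `t • u` the exponential density loses at most a
factor `exp (-t)`, so its value at a point is at most its integral over the ray from there, and this
ray, once translated, stays in `C`. Distinct cones overlap in null sets, so for each `s` all the
charges together cost at most the total mass, however many cones there are
(`IsPartition.lintegral_sum_encard_mul_le`).

For (1) the slope is at most `‖d - c‖ / τ` and the total mass is `1`. For (2), `c + t • x` is
rescaled to `x + s • c` with `s = 1/t` in `[1, 1/α]`. Since `H` is homogeneous, its slope at a zero
is at most `‖x‖ / (τ s)`, not merely `‖c‖ / τ`. Integrating `1/s` gives the logarithm, charging
`‖x‖` times the density to a ray costs a factor `2`, and the mean norm is at most `n`. -/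

/-! ### Counting points by ever finer grids -/

theorem encard_eq_tsum_indicator (Z : Set ℤ) :
    (Z.encard : ℝ≥0∞) = ∑' k : ℤ, Z.indicator 1 k := by
  rw [← Measure.count_apply (DiscreteMeasurableSpace.forall_measurableSet Z),
    ← lintegral_count, lintegral_indicator_one (DiscreteMeasurableSpace.forall_measurableSet Z)]

/-- The number of grid cells `[k / m, (k + 1) / m)` met by `Z`. -/
noncomputable def cellCount (m : ℕ) (Z : Set ℝ) : ℝ≥0∞ :=
  (((fun s : ℝ => ⌊(m : ℝ) * s⌋) '' Z).encard : ℝ≥0∞)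

theorem cellCount_le (m : ℕ) (Z : Set ℝ) : cellCount m Z ≤ (Z.encard : ℝ≥0∞) := by
  unfold cellCount
  exact_mod_cast encard_image_le _ _

theorem eventually_injOn_floor_mul {F : Set ℝ} (hF : F.Finite) :
    ∀ᶠ m : ℕ in atTop, InjOn (fun s : ℝ => ⌊(m : ℝ) * s⌋) F := by
  have h : ∀ x ∈ F, ∀ y ∈ F, ∀ᶠ m : ℕ in atTop, ⌊(m : ℝ) * x⌋ = ⌊(m : ℝ) * y⌋ → x = y := by
    intro x _ y _
    rcases eq_or_ne x y with rfl | hxy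
    · simp
    · have hpos : 0 < |x - y| := abs_pos.2 (sub_ne_zero.2 hxy)
      filter_upwards [(tendsto_natCast_atTop_atTop (R := ℝ)).eventually_ge_atTop
        (1 / |x - y|)] with m hm heq
      have h1 := Int.abs_sub_lt_one_of_floor_eq_floor heq
      rw [← mul_sub, abs_mul, Nat.abs_cast] at h1
      rw [div_le_iff₀ hpos] at hm
      linarith
  have h2 := (hF.eventually_all).2 fun x hx => (hF.eventually_all).2 fun y hy => h x hx y hy
  filter_upwards [h2] with m hm x hx y hy hxy using hm x hx y hy hxy

/-- No cell count exceeds the cardinality, and any finite subset is eventually separated by the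
grid. This makes cardinalities limits of countable sums of indicators, which serves both
measurability and Fatou's lemma. -/
theorem tendsto_cellCount (Z : Set ℝ) :
    Tendsto (fun m => cellCount m Z) atTop (𝓝 (Z.encard : ℝ≥0∞)) := by
  refine tendsto_order.2 ⟨fun a ha => ?_, fun a ha =>
    Eventually.of_forall fun m => (cellCount_le m Z).trans_lt ha⟩
  obtain ⟨F, hFZ, hF, haF⟩ : ∃ F ⊆ Z, F.Finite ∧ a < (F.encard : ℝ≥0∞) := by
    by_cases hZ : Z.Finite
    · exact ⟨Z, subset_rfl, hZ, ha⟩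
    · have hinf : Z.Infinite := hZ
      rw [hinf.encard_eq] at ha
      obtain ⟨N, hN⟩ := ENNReal.exists_nat_gt (ne_of_lt (by simpa using ha))
      obtain ⟨F, hFZ, hF⟩ := hinf.exists_subset_card_eq N
      refine ⟨F, hFZ, F.finite_toSet, ?_⟩
      rw [encard_coe_eq_coe_finsetCard, hF]
      simpa using hN
  filter_upwards [eventually_injOn_floor_mul hF] with m hm
  refine haF.trans_le ?_
  unfold cellCount
  rw [← hm.encard_image]
  exact_mod_cast encard_le_encard (image_mono hFZ)

theorem isClosed_exists_mem_of_isCompact {Y : Type*} [TopologicalSpace Y] {J : Set ℝ} (hJ : IsCompact J) {F : Set (ℝ × Y)}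
    (hF : IsClosed F) : IsClosed {y : Y | ∃ s ∈ J, (s, y) ∈ F} := by
  have : CompactSpace J := isCompact_iff_compactSpace.1 hJ
  have h1 : IsClosed {p : J × Y | ((p.1 : ℝ), p.2) ∈ F} := hF.preimage (by fun_prop)
  convert isClosedMap_snd_of_compactSpace _ h1 using 1
  ext y
  constructor
  · rintro ⟨s, hs, h⟩
    exact ⟨(⟨s, hs⟩, y), h, rfl⟩
  · rintro ⟨⟨s, y⟩, h, rfl⟩
    exact ⟨s, s.2, h⟩

/-! ### Measurability of the number of points in a section -/

section Measurability

variable {Y : Type*} [TopologicalSpace Y] [MeasurableSpace Y] [OpensMeasurableSpace Y]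

/-- A grid cell is half-open, so its intersection with the interval need not be compact. It is
exhausted by countably many compact pieces, and projecting a closed set along a compact factor gives
a closed set. -/
theorem measurableSet_exists_floor_eq (a b : ℝ) (m : ℕ) (k : ℤ) {F : Set (ℝ × Y)}
    (hF : IsClosed F) :
    MeasurableSet {y : Y | ∃ s ∈ Icc a b, ⌊(m : ℝ) * s⌋ = k ∧ (s, y) ∈ F} := by
  have h : {y : Y | ∃ s ∈ Icc a b, ⌊(m : ℝ) * s⌋ = k ∧ (s, y) ∈ F} =
      ⋃ j : ℕ, {y : Y | ∃ s ∈ Icc a b ∩ {s | (k : ℝ) ≤ m * s ∧ m * s ≤ k + 1 - 1 / ((j : ℝ) + 1)},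
        (s, y) ∈ F} := by
    ext y
    simp only [mem_ofPred_eq, mem_iUnion, mem_inter_iff, Int.floor_eq_iff]
    constructor
    · rintro ⟨s, hs, ⟨h1, h2⟩, h3⟩
      obtain ⟨j, hj⟩ := exists_nat_one_div_lt (sub_pos.2 h2)
      exact ⟨j, s, ⟨hs, h1, by linarith⟩, h3⟩
    · rintro ⟨j, s, ⟨hs, h1, h2⟩, h3⟩
      have : 0 < 1 / ((j : ℝ) + 1) := by positivity
      exact ⟨s, hs, ⟨h1, by linarith⟩, h3⟩
  rw [h]
  refine MeasurableSet.iUnion fun j => (isClosed_exists_mem_of_isCompact ?_ hF).measurableSet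
  refine isCompact_Icc.inter_right ?_
  have h1 : IsClosed {s : ℝ | (k : ℝ) ≤ m * s} := isClosed_le (by fun_prop) (by fun_prop)
  have h2 : IsClosed {s : ℝ | m * s ≤ (k : ℝ) + 1 - 1 / ((j : ℝ) + 1)} :=
    isClosed_le (by fun_prop) (by fun_prop)
  exact h1.inter h2

theorem measurable_encard_section (a b : ℝ) {F : Set (ℝ × Y)} (hF : IsClosed F) :
    Measurable fun y : Y => (({s ∈ Icc a b | (s, y) ∈ F} : Set ℝ).encard : ℝ≥0∞) := by
  refine measurable_of_tendsto_metrizable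
    (f := fun (m : ℕ) (y : Y) => cellCount m {s ∈ Icc a b | (s, y) ∈ F}) (fun m => ?_)
    (tendsto_pi_nhds.2 fun y => tendsto_cellCount _)
  simp only [cellCount, encard_eq_tsum_indicator]
  refine Measurable.tsum fun k => ?_
  have : Measurable (indicator _ (1 : Y → ℝ≥0∞)) := measurable_one.indicator
    (measurableSet_exists_floor_eq a b m k hF)
  convert this using 2 with y
  simp only [indicator, mem_image, mem_ofPred_eq, Pi.one_apply]
  congr 1
  apply propext
  constructor
  · rintro ⟨s, ⟨h1, h2⟩, h3⟩
    exact ⟨s, h1, h3, h2⟩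
  · rintro ⟨s, h1, h2, h3⟩
    exact ⟨s, ⟨h1, h3⟩, h2⟩

end Measurability

/-! ### The Banach indicatrix inequality -/

section Indicatrix

variable {g : ℝ → ℝ} {L : NNReal} {I : Set ℝ} {K : ℝ → ℝ}

/-- By Rademacher `g` is differentiable off a null set, whose image is null because `g` is
Lipschitz; elsewhere `K` bounds the derivative. Thus only the local slope enters the bound, while
the global constant `L` does not. -/
theorem volume_image_le_lintegral (hg : LipschitzWith L g) (hK : ∀ s ∈ I, 0 ≤ K s)
    (hgK : ∀ s ∈ I, ∀ᶠ s' in 𝓝 s, |g s' - g s| ≤ K s * |s' - s|)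
    {A : Set ℝ} (hA : MeasurableSet A) (hAI : A ⊆ I) :
    volume (g '' A) ≤ ∫⁻ s in A, ENNReal.ofReal (K s) := by
  set D : Set ℝ := {s | DifferentiableAt ℝ g s} with hD
  have hDm : MeasurableSet D := measurableSet_of_differentiableAt ℝ g
  have hnull : volume (A \ D) = 0 := by
    refine measure_mono_null (fun s hs => hs.2) (ae_iff.1 hg.ae_differentiableAt_real)
  have himg : volume (g '' (A \ D)) = 0 := by
    have h := hg.hausdorffMeasure_image_le (d := 1) zero_le_one (A \ D)
    rw [hausdorffMeasure_real, hnull, mul_zero] at h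
    exact le_antisymm h zero_le
  calc volume (g '' A) = volume (g '' (A ∩ D) ∪ g '' (A \ D)) := by
        rw [← image_union, inter_union_sdiff]
    _ ≤ volume (g '' (A ∩ D)) + volume (g '' (A \ D)) := measure_union_le _ _
    _ = volume (g '' (A ∩ D)) := by rw [himg, add_zero]
    _ ≤ ∫⁻ s in A ∩ D, ENNReal.ofReal |(ContinuousLinearMap.toSpanSingleton ℝ (deriv g s)).det| :=
        addHaar_image_le_lintegral_abs_det_fderiv volume (hA.inter hDm) fun s hs =>
          (DifferentiableAt.hasDerivAt hs.2).hasFDerivAt.hasFDerivWithinAt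
    _ ≤ ∫⁻ s in A ∩ D, ENNReal.ofReal (K s) := by
        refine setLIntegral_mono' (hA.inter hDm) fun s hs => ENNReal.ofReal_le_ofReal ?_
        have := norm_deriv_le_of_lip' (f := g) (x₀ := s) (hK s (hAI hs.1)) (hgK s (hAI hs.1))
        simpa using this
    _ ≤ ∫⁻ s in A, ENNReal.ofReal (K s) := lintegral_mono_set inter_subset_left

theorem setLIntegral_image_le (hg : LipschitzWith L g) (hKm : Measurable K)
    (hK : ∀ s ∈ I, 0 ≤ K s)
    (hgK : ∀ s ∈ I, ∀ᶠ s' in 𝓝 s, |g s' - g s| ≤ K s * |s' - s|)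
    {A : Set ℝ} (hA : MeasurableSet A) (hAI : A ⊆ I) {w : ℝ → ℝ≥0∞} (hw : Measurable w) :
    ∫⁻ r in g '' A, w r ≤ ∫⁻ s in A, ENNReal.ofReal (K s) * w (g s) := by
  have hgm := hg.continuous.measurable
  have hle : volume.restrict (g '' A) ≤
      ((volume.restrict A).withDensity fun s => ENNReal.ofReal (K s)).map g := by
    refine Measure.le_iff.2 fun B hB => ?_
    rw [Measure.restrict_apply hB, Measure.map_apply hgm hB,
      withDensity_apply _ (hgm hB), Measure.restrict_restrict (hgm hB), inter_comm B,
      ← image_inter_preimage, inter_comm A]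
    exact volume_image_le_lintegral hg hK hgK ((hgm hB).inter hA) (inter_subset_right.trans hAI)
  refine (lintegral_mono' hle le_rfl).trans_eq ?_
  rw [lintegral_map hw hgm]
  exact lintegral_withDensity_eq_lintegral_mul _ hKm.ennreal_ofReal (hw.comp hgm)

/-- A weighted Banach indicatrix inequality. -/
theorem lintegral_encard_fiber_mul_le {a b : ℝ} (hg : LipschitzWith L g) (hKm : Measurable K)
    (hK : ∀ s ∈ Icc a b, 0 ≤ K s)
    (hgK : ∀ s ∈ Icc a b, ∀ᶠ s' in 𝓝 s, |g s' - g s| ≤ K s * |s' - s|)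
    {w : ℝ → ℝ≥0∞} (hw : Measurable w) :
    ∫⁻ r, (({s ∈ Icc a b | g s = r} : Set ℝ).encard : ℝ≥0∞) * w r ≤
      ∫⁻ s in Icc a b, ENNReal.ofReal (K s) * w (g s) := by
  have hgc := hg.continuous
  have hF : IsClosed {p : ℝ × ℝ | g p.1 = p.2} := isClosed_eq (by fun_prop) (by fun_prop)
  let cell (m : ℕ) (k : ℤ) : Set ℝ := Icc a b ∩ {s | ⌊(m : ℝ) * s⌋ = k}
  have hcell (m k) : MeasurableSet (cell m k) :=
    measurableSet_Icc.inter ((measurable_const.mul measurable_id).floor (measurableSet_singleton k))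
  have himg (m k) : MeasurableSet (g '' cell m k) := by
    convert measurableSet_exists_floor_eq a b m k hF using 1
    ext r
    simp [cell, and_assoc]
  have hcount (m : ℕ) (r : ℝ) : cellCount m {s ∈ Icc a b | g s = r} =
      ∑' k : ℤ, (g '' cell m k).indicator 1 r := by
    rw [cellCount, encard_eq_tsum_indicator]
    refine tsum_congr fun k => ?_
    simp only [indicator, cell, mem_image, mem_ofPred_eq, mem_inter_iff, Pi.one_apply]
    congr 1
    apply propext
    constructor
    · rintro ⟨s, ⟨h1, h2⟩, h3⟩
      exact ⟨s, ⟨h1, h3⟩, h2⟩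
    · rintro ⟨s, ⟨h1, h2⟩, h3⟩
      exact ⟨s, ⟨h1, h3⟩, h2⟩
  have hmeas (m : ℕ) : Measurable fun r => cellCount m {s ∈ Icc a b | g s = r} := by
    simp only [hcount]
    exact Measurable.tsum fun k => measurable_one.indicator (himg m k)
  have hlim (r : ℝ) : (({s ∈ Icc a b | g s = r} : Set ℝ).encard : ℝ≥0∞) * w r ≤
      liminf (fun m => cellCount m {s ∈ Icc a b | g s = r} * w r) atTop := by
    rw [← (tendsto_cellCount _).liminf_eq]
    exact ENNReal.le_liminf_mul.trans' (by simp)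
  -- Fatou reduces the claim to a fixed grid, where each cell contributes the indicator of its
  -- image.
  calc _ ≤ ∫⁻ r, liminf (fun m => cellCount m {s ∈ Icc a b | g s = r} * w r) atTop :=
        lintegral_mono hlim
    _ ≤ liminf (fun m => ∫⁻ r, cellCount m {s ∈ Icc a b | g s = r} * w r) atTop :=
        lintegral_liminf_le fun m => (hmeas m).mul hw
    _ ≤ liminf (fun _ : ℕ => ∫⁻ s in Icc a b, ENNReal.ofReal (K s) * w (g s)) atTop := by
        refine liminf_le_liminf (Eventually.of_forall fun m => ?_)
        simp only [hcount, ← ENNReal.tsum_mul_right]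
        have hm (k : ℤ) : AEMeasurable (fun r => (g '' cell m k).indicator (1 : ℝ → ℝ≥0∞) r * w r) :=
          ((measurable_one.indicator (himg m k)).mul hw).aemeasurable
        rw [lintegral_tsum hm]
        have hI : Icc a b = ⋃ k, cell m k := by
          ext s
          simp [cell]
        rw [hI, lintegral_iUnion (hcell m) (fun k l hkl => Set.disjoint_left.2
          fun s h1 h2 => hkl (h1.2.symm.trans h2.2))]
        refine ENNReal.tsum_le_tsum fun k => ?_
        refine le_of_eq_of_le ?_ (setLIntegral_image_le hg hKm hK hgK (hcell m k)
          inter_subset_left hw)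
        rw [← lintegral_indicator (himg m k)]
        refine lintegral_congr fun r => ?_
        by_cases hr : r ∈ g '' cell m k <;> simp [hr]
    _ = _ := by simp

end Indicatrix

/-! ### A wide cone as an epigraph -/

section Height

variable {E : Type*} [NormedAddCommGroup E] [NormedSpace ℝ E] {C : PointedCone ℝ E}
  {u : E} {τ : ℝ} {H : E → ℝ}

theorem add_smul_mem_of_norm_le (hτ : 0 < τ) (hu : Metric.closedBall u τ ⊆ (C : Set E)) {w : E}
    {r : ℝ} (hw : ‖w‖ ≤ r * τ) : w + r • u ∈ C := by
  rcases eq_or_ne r 0 with rfl | hr0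
  · have : w = 0 := by simpa using hw
    simp [this]
  · have hr : 0 < r := lt_of_le_of_ne
      (nonneg_of_mul_nonneg_left ((norm_nonneg w).trans hw) hτ) hr0.symm
    have h : r⁻¹ • w + u ∈ C := by
      refine hu (mem_closedBall_iff_norm.2 ?_)
      rw [add_sub_cancel_right, norm_smul, norm_inv, Real.norm_of_nonneg hr.le,
        inv_mul_le_iff₀ hr]
      exact hw
    have := C.smul_mem hr.le h
    rwa [smul_add, smul_inv_smul₀ hr0] at this

/-- A closed wide cone other than the whole space is the epigraph of a function in the
direction of the center of its ball. -/
theorem exists_height (hC : IsClosed (C : Set E)) (hτ : 0 < τ)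
    (hu : Metric.closedBall u τ ⊆ (C : Set E)) (hne : (C : Set E) ≠ univ) :
    ∃ H : E → ℝ, ∀ x r, x + r • u ∈ C ↔ H x ≤ r := by
  have hup {x : E} {r r' : ℝ} (hr : x + r • u ∈ C) (hrr : r ≤ r') : x + r' • u ∈ C := by
    have h := C.add_mem hr (C.smul_mem (sub_nonneg.2 hrr)
      (hu (Metric.mem_closedBall_self hτ.le)))
    rwa [add_assoc, ← add_smul, add_sub_cancel] at h
  have hnonempty (x : E) : {r : ℝ | x + r • u ∈ C}.Nonempty :=
    ⟨‖x‖ / τ, add_smul_mem_of_norm_le hτ hu (by rw [div_mul_cancel₀ _ hτ.ne'])⟩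
  have hbdd (x : E) : BddBelow {r : ℝ | x + r • u ∈ C} := by
    by_contra hb
    -- If a whole line in direction `u` lies in `C`, rescaling and closedness put `-u` in `C`;
    -- together with the ball around `u` this generates the whole space.
    refine hne (eq_univ_of_forall fun z => ?_)
    have hall (r : ℝ) : x + r • u ∈ C := by
      obtain ⟨r', hr', hlt⟩ := not_bddBelow_iff.1 hb r
      exact hup hr' hlt.le
    have hneg : -u ∈ C := by
      have hlim : Tendsto (fun m : ℝ => m⁻¹ • x - u) atTop (𝓝 ((0 : ℝ) • x - u)) :=
        (tendsto_inv_atTop_zero.smul_const x).sub_const u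
      rw [zero_smul, zero_sub] at hlim
      refine hC.mem_of_tendsto hlim ?_
      filter_upwards [eventually_gt_atTop 0] with m hm
      have h := C.smul_mem (inv_nonneg.2 hm.le) (hall (-m))
      rwa [smul_add, smul_smul, mul_neg, inv_mul_cancel₀ hm.ne', neg_one_smul,
        ← sub_eq_add_neg] at h
    have h1 : z + (‖z‖ / τ) • u ∈ C :=
      add_smul_mem_of_norm_le hτ hu (by rw [div_mul_cancel₀ _ hτ.ne'])
    have h2 := C.add_mem h1 (C.smul_mem (show 0 ≤ ‖z‖ / τ by positivity) hneg)
    simpa using h2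
  refine ⟨fun x => sInf {r : ℝ | x + r • u ∈ C}, fun x r => ⟨fun h => csInf_le (hbdd x) h,
    fun h => ?_⟩⟩
  have hcl : IsClosed {r : ℝ | x + r • u ∈ C} :=
    hC.preimage (f := fun r : ℝ => x + r • u) (by fun_prop)
  exact hup (hcl.csInf_mem (hnonempty x) (hbdd x)) h

variable (hH : ∀ x r, x + r • u ∈ C ↔ H x ≤ r)

include hH

theorem mem_iff_height_nonpos (x : E) : x ∈ C ↔ H x ≤ 0 := by
  simpa using hH x 0

theorem height_add_smul (x : E) (t : ℝ) : H (x + t • u) = H x - t := by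
  refine eq_of_forall_ge_iff fun r => ?_
  rw [← hH, add_assoc, ← add_smul, hH, sub_le_iff_le_add']

theorem height_add_le (hτ : 0 < τ) (hu : Metric.closedBall u τ ⊆ (C : Set E)) (x w : E) :
    H (x + w) ≤ H x + ‖w‖ / τ := by
  rw [← hH]
  have h := C.add_mem ((hH x (H x)).2 le_rfl) (add_smul_mem_of_norm_le hτ hu (w := w)
    (r := ‖w‖ / τ) (by rw [div_mul_cancel₀ _ hτ.ne']))
  rwa [add_add_add_comm, ← add_smul] at h

theorem abs_height_sub_le (hτ : 0 < τ) (hu : Metric.closedBall u τ ⊆ (C : Set E)) (x y : E) :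
    |H x - H y| ≤ ‖x - y‖ / τ := by
  have h1 := height_add_le hH hτ hu y (x - y)
  have h2 := height_add_le hH hτ hu x (y - x)
  rw [add_sub_cancel] at h1 h2
  rw [norm_sub_rev] at h2
  exact abs_sub_le_iff.2 ⟨by linarith, by linarith⟩

theorem lipschitzWith_height (hτ : 0 < τ) (hu : Metric.closedBall u τ ⊆ (C : Set E)) :
    LipschitzWith (Real.toNNReal τ⁻¹) H :=
  LipschitzWith.of_dist_le' fun x y => by
    rw [Real.dist_eq, dist_eq_norm, inv_mul_eq_div]
    exact abs_height_sub_le hH hτ hu x y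

theorem height_eq_zero_of_mem_frontier (hHc : Continuous H) (hC : IsClosed (C : Set E)) {x : E}
    (hx : x ∈ frontier (C : Set E)) : H x = 0 := by
  refine le_antisymm ((mem_iff_height_nonpos hH x).1 (hC.frontier_subset hx)) ?_
  by_contra! hlt
  refine hx.2 (interior_maximal (s := (C : Set E)) (t := {y | H y < 0}) (fun y hy => ?_)
    (isOpen_lt hHc continuous_const) hlt)
  exact (mem_iff_height_nonpos hH y).2 (le_of_lt hy)

theorem height_smul {t : ℝ} (ht : 0 < t) (x : E) : H (t • x) = t * H x := by
  refine eq_of_forall_ge_iff fun r => ?_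
  have hiff : t • x + r • u ∈ C ↔ x + (r / t) • u ∈ C := by
    constructor <;> intro h
    · have := C.smul_mem (inv_nonneg.2 ht.le) h
      rwa [smul_add, inv_smul_smul₀ ht.ne', smul_smul, inv_mul_eq_div] at this
    · have := C.smul_mem ht.le h
      rwa [smul_add, smul_smul, mul_div_cancel₀ _ ht.ne'] at this
  rw [← hH, hiff, hH, le_div_iff₀' ht]

end Height

/-! ### Integration along lines in a fixed direction -/

section Unfolding

variable {E : Type*} [NormedAddCommGroup E] [NormedSpace ℝ E] [MeasurableSpace E] [BorelSpace E]
  [FiniteDimensional ℝ E]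
  (μ : Measure E) [μ.IsAddHaarMeasure]

/-- For each point, the shifts along `u` that bring it into the slab form an interval of length `1`.
The slab thus replaces a choice of complement to the line and of a measure on it. -/
theorem lintegral_eq_lintegral_slab (l : E →L[ℝ] ℝ) {u : E} (hl : l u = 1) {F : E → ℝ≥0∞}
    (hF : Measurable F) :
    ∫⁻ x, F x ∂μ = ∫⁻ x in l ⁻¹' Ico 0 1, (∫⁻ r : ℝ, F (x + r • u)) ∂μ := by
  have hI : MeasurableSet (l ⁻¹' Ico (0 : ℝ) 1) := l.continuous.measurable measurableSet_Ico
  have hp : ProperSpace E := FiniteDimensional.proper ℝ E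
  have hind : Measurable ((l ⁻¹' Ico (0 : ℝ) 1).indicator (1 : E → ℝ≥0∞)) :=
    measurable_one.indicator hI
  have hm1 : Measurable fun p : E × ℝ =>
      (l ⁻¹' Ico (0 : ℝ) 1).indicator (1 : E → ℝ≥0∞) p.1 * F (p.1 + p.2 • u) :=
    (hind.comp measurable_fst).mul (hF.comp (by fun_prop))
  have hm2 : Measurable fun p : ℝ × E =>
      (l ⁻¹' Ico (0 : ℝ) 1).indicator (1 : E → ℝ≥0∞) (p.2 - p.1 • u) * F p.2 :=
    (hind.comp (by fun_prop)).mul (hF.comp measurable_snd)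
  symm
  calc ∫⁻ x in l ⁻¹' Ico 0 1, (∫⁻ r : ℝ, F (x + r • u)) ∂μ
      = ∫⁻ x, (∫⁻ r : ℝ, (l ⁻¹' Ico (0 : ℝ) 1).indicator 1 x * F (x + r • u)) ∂μ := by
        rw [← lintegral_indicator hI]
        refine lintegral_congr fun x => ?_
        by_cases hx : x ∈ l ⁻¹' Ico (0 : ℝ) 1 <;> simp only [hx, not_false_eq_true,
          indicator_of_mem, indicator_of_notMem, Pi.one_apply, one_mul, zero_mul, lintegral_zero]
    _ = ∫⁻ r : ℝ, ∫⁻ x, (l ⁻¹' Ico (0 : ℝ) 1).indicator 1 x * F (x + r • u) ∂μ :=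
        lintegral_lintegral_swap hm1.aemeasurable
    _ = ∫⁻ r : ℝ, ∫⁻ x, (l ⁻¹' Ico (0 : ℝ) 1).indicator 1 (x - r • u) * F x ∂μ := by
        refine lintegral_congr fun r => ?_
        have h := lintegral_add_right_eq_self (μ := μ)
          (fun x => (l ⁻¹' Ico (0 : ℝ) 1).indicator 1 (x - r • u) * F x) (r • u)
        simpa only [add_sub_cancel_right] using h
    _ = ∫⁻ x, (∫⁻ r : ℝ, (l ⁻¹' Ico (0 : ℝ) 1).indicator 1 (x - r • u) * F x) ∂μ :=
        lintegral_lintegral_swap hm2.aemeasurable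
    _ = ∫⁻ x, F x ∂μ := by
        refine lintegral_congr fun x => ?_
        have hset (r : ℝ) : (l ⁻¹' Ico (0 : ℝ) 1).indicator (1 : E → ℝ≥0∞) (x - r • u) =
            (Ioc (l x - 1) (l x)).indicator 1 r := by
          simp only [indicator, mem_preimage, map_sub, map_smul, hl, smul_eq_mul, mul_one, mem_Ico,
            mem_Ioc, Pi.one_apply]
          congr 1
          apply propext
          constructor <;> rintro ⟨h1, h2⟩ <;> constructor <;> linarith
        simp only [hset]
        rw [lintegral_mul_const _ (measurable_one.indicator measurableSet_Ioc),
          lintegral_indicator_one measurableSet_Ioc]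
        simp

end Unfolding

/-! ### Crossings of the boundary of one cone -/

section ConeBound

variable {E : Type*} [NormedAddCommGroup E] [NormedSpace ℝ E] [MeasurableSpace E] [BorelSpace E]
  [FiniteDimensional ℝ E] (μ : Measure E) [μ.IsAddHaarMeasure]
  {C : PointedCone ℝ E} {u : E} {τ : ℝ} {H : E → ℝ}

/-- The charging argument: `w` weights the crossings, and `W` is the mass that pays for them along
rays into the cone. The slope bound `hloc` is asked only at zeros of `H`, which is what lets
homogeneity be used for dilations. -/
theorem lintegral_encard_height_zeros_mul_le (hC : IsClosed (C : Set E)) (hu0 : u ≠ 0)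
    (hτ : 0 < τ) (hu : Metric.closedBall u τ ⊆ (C : Set E))
    (hH : ∀ x r, x + r • u ∈ C ↔ H x ≤ r)
    {a b : ℝ} {p v : E} {κ : ℝ → ℝ} {k : E → ℝ} (hκm : Measurable κ) (hkm : Measurable k)
    (hκ : ∀ s ∈ Icc a b, 0 ≤ κ s) (hk : ∀ y, 0 ≤ k y)
    (hloc : ∀ s ∈ Icc a b, ∀ q, H (q + (p + s • v)) = 0 →
      ∀ᶠ s' in 𝓝 s, |H (q + (p + s' • v))| ≤ κ s * k q * |s' - s|)
    {w W : E → ℝ≥0∞} (hw : Measurable w) (hW : Measurable W)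
    (hwW : ∀ y, ENNReal.ofReal (k y) * w y ≤ ∫⁻ t in Ioi (0 : ℝ), W (y + t • u)) :
    ∫⁻ x, (({s ∈ Icc a b | H (x + (p + s • v)) = 0} : Set ℝ).encard : ℝ≥0∞) * w x ∂μ ≤
      ∫⁻ s in Icc a b, ENNReal.ofReal (κ s) *
        ∫⁻ x, (C : Set E).indicator 1 (x + (p + s • v)) * W x ∂μ := by
  have hproper : ProperSpace E := FiniteDimensional.proper ℝ E
  have hHl := lipschitzWith_height hH hτ hu
  have hHc : Continuous H := hHl.continuous
  have hHm : Measurable H := hHc.measurable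
  have hnu : ‖u‖ ≠ 0 := norm_ne_zero_iff.2 hu0
  obtain ⟨l₀, -, hl₀⟩ := exists_dual_vector ℝ u hnu
  obtain ⟨l, hl⟩ : ∃ l : E →L[ℝ] ℝ, l u = 1 := ⟨‖u‖⁻¹ • l₀, by
    rw [smul_apply, hl₀]
    simp [hnu]⟩
  have hγ (x : E) : LipschitzWith ‖v‖₊ fun s : ℝ => x + (p + s • v) :=
    LipschitzWith.of_dist_le_mul fun s t => by
      rw [dist_add_left, dist_add_left, dist_eq_norm, ← sub_smul, norm_smul, dist_eq_norm,
        mul_comm]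
      rfl
  have hN : Measurable fun x : E =>
      (({s ∈ Icc a b | H (x + (p + s • v)) = 0} : Set ℝ).encard : ℝ≥0∞) :=
    measurable_encard_section a b (F := {q : ℝ × E | H (q.2 + (p + q.1 • v)) = 0})
      (isClosed_eq (by fun_prop) continuous_const)
  have hD : Measurable fun q : ℝ × E =>
      (C : Set E).indicator (1 : E → ℝ≥0∞) (q.2 + (p + q.1 • v)) * W q.2 :=
    ((measurable_one.indicator hC.measurableSet).comp (by fun_prop)).mul (hW.comp measurable_snd)
  -- After translation by `p + s • v`, the ray starts at height `0` and goes up, so it stays in `C`.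
  have hray (x : E) (s : ℝ) :
      ∫⁻ t in Ioi (0 : ℝ), W (x + H (x + (p + s • v)) • u + t • u) ≤
        ∫⁻ r : ℝ, (C : Set E).indicator 1 (x + r • u + (p + s • v)) * W (x + r • u) := by
    rw [← lintegral_add_left_eq_self (μ := volume) _ (H (x + (p + s • v))),
      ← lintegral_indicator measurableSet_Ioi]
    refine lintegral_mono (indicator_le fun t ht => ?_)
    have hmem : x + (H (x + (p + s • v)) + t) • u + (p + s • v) ∈ (C : Set E) := by
      rw [add_right_comm]
      exact (hH _ _).2 (by linarith [mem_Ioi.1 ht])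
    rw [indicator_of_mem hmem, Pi.one_apply, one_mul, add_assoc, ← add_smul]
  have hfiber (x : E) :
      ∫⁻ r : ℝ, (({s ∈ Icc a b | H (x + r • u + (p + s • v)) = 0} : Set ℝ).encard : ℝ≥0∞) *
          w (x + r • u) ≤
        ∫⁻ s in Icc a b, ENNReal.ofReal (κ s) *
          ∫⁻ r : ℝ, (C : Set E).indicator 1 (x + r • u + (p + s • v)) * W (x + r • u) := by
    have hset (r : ℝ) : {s ∈ Icc a b | H (x + r • u + (p + s • v)) = 0} =
        {s ∈ Icc a b | H (x + (p + s • v)) = r} := by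
      ext s
      simp only [mem_ofPred_eq, add_right_comm x (r • u), height_add_smul hH, sub_eq_zero]
    simp only [hset]
    have hgm : Measurable fun s : ℝ => x + H (x + (p + s • v)) • u := by fun_prop
    refine (lintegral_encard_fiber_mul_le (hHl.comp (hγ x))
      (K := fun s => κ s * k (x + H (x + (p + s • v)) • u)) (hκm.mul (hkm.comp hgm))
      (fun s hs => mul_nonneg (hκ s hs) (hk _)) (fun s hs => ?_)
      (hw.comp (by fun_prop : Measurable fun r : ℝ => x + r • u))).trans ?_
    · have h0 : H (x + H (x + (p + s • v)) • u + (p + s • v)) = 0 := by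
        rw [add_right_comm, height_add_smul hH, sub_self]
      filter_upwards [hloc s hs _ h0] with s' hs'
      rwa [add_right_comm, height_add_smul hH] at hs'
    · refine setLIntegral_mono' measurableSet_Icc fun s hs => ?_
      simp only [Function.comp_apply]
      rw [ENNReal.ofReal_mul (hκ s hs), mul_assoc]
      gcongr
      exact (hwW _).trans (hray x s)
  calc _ = ∫⁻ x in l ⁻¹' Ico 0 1, (∫⁻ r : ℝ,
          (({s ∈ Icc a b | H (x + r • u + (p + s • v)) = 0} : Set ℝ).encard : ℝ≥0∞) *
            w (x + r • u)) ∂μ := lintegral_eq_lintegral_slab μ l hl (hN.mul hw)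
    _ ≤ ∫⁻ x in l ⁻¹' Ico 0 1, (∫⁻ s in Icc a b, ENNReal.ofReal (κ s) *
          ∫⁻ r : ℝ, (C : Set E).indicator 1 (x + r • u + (p + s • v)) * W (x + r • u)) ∂μ :=
        lintegral_mono hfiber
    _ = ∫⁻ s in Icc a b, (∫⁻ x in l ⁻¹' Ico 0 1, (ENNReal.ofReal (κ s) *
          ∫⁻ r : ℝ, (C : Set E).indicator 1 (x + r • u + (p + s • v)) * W (x + r • u)) ∂μ) := by
        refine lintegral_lintegral_swap (Measurable.aemeasurable ?_)
        refine (hκm.ennreal_ofReal.comp measurable_snd).mul ?_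
        exact Measurable.lintegral_prod_right' (f := fun q : (E × ℝ) × ℝ =>
          (C : Set E).indicator 1 (q.1.1 + q.2 • u + (p + q.1.2 • v)) * W (q.1.1 + q.2 • u))
          (hD.comp (by fun_prop :
            Measurable fun q : (E × ℝ) × ℝ => (q.1.2, q.1.1 + q.2 • u)))
    _ = _ := by
        refine lintegral_congr fun s => ?_
        have hDs : Measurable fun x : E =>
            (C : Set E).indicator (1 : E → ℝ≥0∞) (x + (p + s • v)) * W x :=
          hD.comp measurable_prodMk_left
        rw [lintegral_eq_lintegral_slab μ l hl hDs, lintegral_const_mul]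
        exact Measurable.lintegral_prod_right' (f := fun q : E × ℝ =>
          (C : Set E).indicator 1 (q.1 + q.2 • u + (p + s • v)) * W (q.1 + q.2 • u))
          (hDs.comp (by fun_prop : Measurable fun q : E × ℝ => q.1 + q.2 • u))

end ConeBound

/-! ### Cones of a partition are essentially disjoint -/

theorem subset_of_isExtreme_inter {E : Type*} [NormedAddCommGroup E] [NormedSpace ℝ E]
    {A B : Set E} (h : IsExtreme ℝ A (A ∩ B))
    (hne : (interior (A ∩ B)).Nonempty) : A ⊆ B := by
  obtain ⟨z, hz⟩ := hne
  intro y hy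
  -- Stepping from `z` slightly away from `y` stays in the intersection and puts `z` strictly
  -- between two points of `A`; extremality then captures `y`.
  have hlim : Tendsto (fun ε : ℝ => z - ε • (y - z)) (𝓝[>] 0) (𝓝 z) := by
    have : Continuous fun ε : ℝ => z - ε • (y - z) := by fun_prop
    simpa using (this.tendsto 0).mono_left nhdsWithin_le_nhds
  obtain ⟨ε, hε, hεpos⟩ := ((hlim.eventually_mem (mem_interior_iff_mem_nhds.1 hz)).and
    self_mem_nhdsWithin).exists
  have hεpos : 0 < ε := hεpos
  refine (h.left_mem_of_mem_openSegment hy hε.1 (interior_subset hz)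
    ⟨ε / (1 + ε), 1 / (1 + ε), by positivity, by positivity, by rw [← add_div, add_comm, div_self (by positivity)], ?_⟩).2
  match_scalars <;> field_simp <;> ring

section Partition

variable {E : Type*} [NormedAddCommGroup E] [NormedSpace ℝ E] [MeasurableSpace E] [BorelSpace E]
  [FiniteDimensional ℝ E] (μ : Measure E) [μ.IsAddHaarMeasure]

theorem IsPartition.measure_inter_eq_zero {T : Finset (PointedCone ℝ E)} {S : PointedCone ℝ E}
    (hT : IsPartition T S) {C D : PointedCone ℝ E} (hC : C ∈ T) (hD : D ∈ T) (hCD : C ≠ D) :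
    μ ((C : Set E) ∩ D) = 0 := by
  have hconv : Convex ℝ ((C : Set E) ∩ D) := C.convex.inter D.convex
  have hint : interior ((C : Set E) ∩ D) = ∅ := by
    by_contra hne
    have hne := nonempty_iff_ne_empty.2 hne
    obtain ⟨h1, h2⟩ := hT.isExtreme_inter C hC D hD hCD
    refine hCD (SetLike.coe_injective (Subset.antisymm (subset_of_isExtreme_inter h1 hne) ?_))
    rw [inter_comm] at h2 hne
    exact subset_of_isExtreme_inter h2 hne
  have hcl := (hT.isClosed_of_mem C hC).inter (hT.isClosed_of_mem D hD)
  rw [← hcl.closure_eq, closure_eq_interior_union_frontier, hint, empty_union]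
  exact hconv.addHaar_frontier μ

theorem IsPartition.sum_lintegral_indicator_mul_le {T : Finset (PointedCone ℝ E)}
    {S : PointedCone ℝ E} (hT : IsPartition T S) (z : E) {W : E → ℝ≥0∞} (hW : Measurable W) :
    ∑ C ∈ T, ∫⁻ x, (C : Set E).indicator 1 (x + z) * W x ∂μ ≤ ∫⁻ x, W x ∂μ := by
  have hproper : ProperSpace E := FiniteDimensional.proper ℝ E
  rw [← lintegral_finsetSum' _ fun C hC => ?_]
  swap
  · exact (((measurable_one.indicator (hT.isClosed_of_mem C hC).measurableSet).comp
      (measurable_id.add_const z)).mul hW).aemeasurable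
  have hae : ∀ C ∈ T, ∀ D ∈ T, ∀ᵐ x ∂μ, x + z ∈ C → x + z ∈ D → C = D := by
    intro C hC D hD
    by_cases hCD : C = D
    · simp [hCD]
    · have h := hT.measure_inter_eq_zero μ hC hD hCD
      rw [← measure_preimage_add_right μ z] at h
      filter_upwards [measure_eq_zero_iff_ae_notMem.1 h] with x hx h1 h2
      exact (hx ⟨h1, h2⟩).elim
  have hae2 := (T.eventually_all).2 fun C hC => (T.eventually_all).2 fun D hD => hae C hC D hD
  refine lintegral_mono_ae ?_
  filter_upwards [hae2] with x hx
  by_cases h : ∃ C ∈ T, x + z ∈ C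
  · obtain ⟨C, hC, hxC⟩ := h
    rw [Finset.sum_eq_single_of_mem C hC fun D hD hDC => ?_]
    · exact mul_le_of_le_one_left' (indicator_le_self' (fun _ _ => zero_le) _)
    · rw [indicator_of_notMem (fun hxD => hDC (hx D hD C hC hxD hxC)), zero_mul]
  · push Not at h
    rw [Finset.sum_eq_zero fun C hC => by rw [indicator_of_notMem (h C hC), zero_mul]]
    exact zero_le

end Partition

/-! ### One-dimensional exponential integrals -/

theorem lintegral_exp_neg_Ioi_zero : ∫⁻ t in Ioi (0 : ℝ), ENNReal.ofReal (Real.exp (-t)) = 1 := by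
  rw [← ofReal_integral_eq_lintegral_ofReal (integrableOn_exp_neg_Ioi 0)
    (Eventually.of_forall fun t => (Real.exp_pos _).le), integral_exp_neg_Ioi_zero,
    ENNReal.ofReal_one]

theorem hasDerivAt_sub_add_one_mul_exp_neg (a t : ℝ) :
    HasDerivAt (fun t => (t - a + 1) * Real.exp (-t)) ((a - t) * Real.exp (-t)) t := by
  have h1 : HasDerivAt (fun t : ℝ => t - a + 1) 1 t := ((hasDerivAt_id t).sub_const a).add_const 1
  have h2 : HasDerivAt (fun t : ℝ => Real.exp (-t)) (Real.exp (-t) * -1) t :=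
    (hasDerivAt_neg t).exp
  exact (h1.mul h2).congr_deriv (by ring)

/-- This is the source of the factor `2` in (2): along a ray the norm may first shrink, and `|a -
t|` is the lower bound the triangle inequality leaves. -/
theorem ofReal_le_two_mul_lintegral_abs_sub_mul_exp_neg {a : ℝ} (ha : 0 ≤ a) :
    ENNReal.ofReal a ≤
      2 * ∫⁻ t in Ioi (0 : ℝ), ENNReal.ofReal (|a - t| * Real.exp (-t)) := by
  have h1 : ∫⁻ t in Ioc 0 a, ENNReal.ofReal (|a - t| * Real.exp (-t)) =
      ENNReal.ofReal (Real.exp (-a) - (1 - a)) := by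
    have hc : Continuous fun t => (a - t) * Real.exp (-t) := by fun_prop
    have hi : ∫ t in (0 : ℝ)..a, (a - t) * Real.exp (-t) = Real.exp (-a) - (1 - a) := by
      rw [intervalIntegral.integral_eq_sub_of_hasDerivAt
        (fun t _ => hasDerivAt_sub_add_one_mul_exp_neg a t) (hc.intervalIntegrable _ _)]
      simp
      ring
    rw [← hi, intervalIntegral.integral_of_le ha, ofReal_integral_eq_lintegral_ofReal
      ((hc.intervalIntegrable 0 a).1)]
    · refine setLIntegral_congr_fun measurableSet_Ioc fun t ht => ?_
      simp only [abs_of_nonneg (sub_nonneg.2 ht.2)]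
    · refine (ae_restrict_iff' measurableSet_Ioc).2 (Eventually.of_forall fun t ht => ?_)
      exact mul_nonneg (sub_nonneg.2 ht.2) (Real.exp_pos _).le
  have h2 : ∫⁻ t in Ioi a, ENNReal.ofReal (|a - t| * Real.exp (-t)) =
      ENNReal.ofReal (Real.exp (-a)) := by
    have hd (t : ℝ) : HasDerivAt (fun t => -((t - a + 1) * Real.exp (-t)))
        ((t - a) * Real.exp (-t)) t :=
      (hasDerivAt_sub_add_one_mul_exp_neg a t).neg.congr_deriv (by ring)
    have hlim : Tendsto (fun t => -((t - a + 1) * Real.exp (-t))) atTop (𝓝 0) := by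
      have h3 := Real.tendsto_pow_mul_exp_neg_atTop_nhds_zero 1
      have h4 := (Real.tendsto_exp_neg_atTop_nhds_zero).const_mul (1 - a)
      convert (h3.add h4).neg using 1
      · ext t; ring
      · simp
    have hpos (t : ℝ) (ht : t ∈ Ioi a) : 0 ≤ (t - a) * Real.exp (-t) :=
      mul_nonneg (sub_nonneg.2 (le_of_lt ht)) (Real.exp_pos _).le
    have hi := integral_Ioi_of_hasDerivAt_of_nonneg' (fun t _ => hd t) hpos hlim
    have hint := integrableOn_Ioi_deriv_of_nonneg' (fun t _ => hd t) hpos hlim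
    have hval : Real.exp (-a) = ∫ t in Ioi a, (t - a) * Real.exp (-t) := by
      rw [hi]; simp
    rw [hval, ofReal_integral_eq_lintegral_ofReal hint]
    · refine setLIntegral_congr_fun measurableSet_Ioi fun t ht => ?_
      have hat : a < t := ht
      simp only [abs_of_nonpos (sub_nonpos.2 hat.le), neg_sub]
    · exact (ae_restrict_iff' measurableSet_Ioi).2 (Eventually.of_forall hpos)
  -- The two pieces add up to `a - 1 + 2 * exp (-a)`, whose double must be at least `a`. This
  -- follows from `1 + x ≤ exp x` at `x = 1 - a` and `e < 4`.
  have hexp : 2 - a ≤ 4 * Real.exp (-a) := by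
    have h3 := Real.add_one_le_exp (1 - a)
    have h4 : Real.exp (1 - a) ≤ 4 * Real.exp (-a) := by
      rw [sub_eq_add_neg, Real.exp_add]
      gcongr
      linarith [Real.exp_one_lt_d9]
    linarith
  rw [← Ioc_union_Ioi_eq_Ioi ha, lintegral_union measurableSet_Ioi Ioc_disjoint_Ioi_same, h1, h2,
    ← ENNReal.ofReal_add (by linarith [Real.add_one_le_exp (-a)]) (Real.exp_pos _).le,
    ← ENNReal.ofReal_ofNat 2, ← ENNReal.ofReal_mul zero_le_two]
  exact ENNReal.ofReal_le_ofReal (by linarith)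

/-! ### The exponential density along rays and under scaling -/

section Density

variable {E : Type*} [NormedAddCommGroup E] [NormedSpace ℝ E] [MeasureSpace E]
  {S : PointedCone ℝ E} {u : E}

theorem exp_neg_mul_expDensity_le (hu : u ∈ S) (hu1 : ‖u‖ = 1) {t : ℝ} (ht : 0 ≤ t) (y : E) :
    ENNReal.ofReal (Real.exp (-t)) * expDensity S y ≤ expDensity S (y + t • u) := by
  unfold expDensity
  by_cases hy : y ∈ (S : Set E)
  · have hy' : y + t • u ∈ (S : Set E) := S.add_mem hy (S.smul_mem ht hu)
    rw [indicator_of_mem hy, indicator_of_mem hy', mul_left_comm,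
      ← ENNReal.ofReal_mul (Real.exp_pos _).le, ← Real.exp_add]
    gcongr
    have := norm_add_le y (t • u)
    rw [norm_smul, hu1, mul_one, Real.norm_of_nonneg ht] at this
    linarith
  · simp [indicator_of_notMem hy]

theorem expDensity_le_lintegral (hu : u ∈ S) (hu1 : ‖u‖ = 1) (y : E) :
    expDensity S y ≤ ∫⁻ t in Ioi (0 : ℝ), expDensity S (y + t • u) := by
  calc expDensity S y
      = ∫⁻ t in Ioi (0 : ℝ), ENNReal.ofReal (Real.exp (-t)) * expDensity S y := by
        rw [lintegral_mul_const _ (by fun_prop), lintegral_exp_neg_Ioi_zero, one_mul]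
    _ ≤ _ := setLIntegral_mono' measurableSet_Ioi fun t ht =>
        exp_neg_mul_expDensity_le hu hu1 (le_of_lt ht) y

theorem norm_mul_expDensity_le_lintegral (hu : u ∈ S) (hu1 : ‖u‖ = 1) (y : E) :
    ENNReal.ofReal ‖y‖ * expDensity S y ≤
      2 * ∫⁻ t in Ioi (0 : ℝ), ENNReal.ofReal ‖y + t • u‖ * expDensity S (y + t • u) := by
  calc ENNReal.ofReal ‖y‖ * expDensity S y
      ≤ 2 * (∫⁻ t in Ioi (0 : ℝ), ENNReal.ofReal (|‖y‖ - t| * Real.exp (-t))) *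
          expDensity S y := by
        gcongr
        exact ofReal_le_two_mul_lintegral_abs_sub_mul_exp_neg (norm_nonneg y)
    _ = 2 * ∫⁻ t in Ioi (0 : ℝ),
          ENNReal.ofReal (|‖y‖ - t| * Real.exp (-t)) * expDensity S y := by
        rw [lintegral_mul_const _ (by fun_prop), mul_assoc]
    _ ≤ _ := by
        gcongr 2 * ?_
        refine setLIntegral_mono' measurableSet_Ioi fun t ht => ?_
        rw [ENNReal.ofReal_mul (abs_nonneg _), mul_assoc]
        refine mul_le_mul' (ENNReal.ofReal_le_ofReal ?_)
          (exp_neg_mul_expDensity_le hu hu1 (le_of_lt ht) y)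
        have h := abs_norm_sub_norm_le y (-(t • u))
        rwa [norm_neg, norm_smul, hu1, mul_one, Real.norm_of_nonneg (le_of_lt ht),
          sub_neg_eq_add] at h

theorem add_mul_expDensity_le {ε : ℝ} (hε : 0 < ε) (x : E) :
    expDensity S x + ENNReal.ofReal (ε / (1 + ε)) * (ENNReal.ofReal ‖x‖ * expDensity S x) ≤
      expDensity S ((1 + ε)⁻¹ • x) := by
  have hε1 : 0 < 1 + ε := by linarith
  unfold expDensity
  by_cases hx : x ∈ (S : Set E)
  · have hx' : (1 + ε)⁻¹ • x ∈ (S : Set E) := S.smul_mem (inv_nonneg.2 hε1.le) hx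
    rw [indicator_of_mem hx, indicator_of_mem hx', ← mul_assoc, ← one_add_mul,
      mul_left_comm, ← ENNReal.ofReal_one, ← ENNReal.ofReal_mul (by positivity),
      ← ENNReal.ofReal_add zero_le_one (by positivity), ← ENNReal.ofReal_mul (by positivity)]
    gcongr
    have h : -‖(1 + ε)⁻¹ • x‖ = ε / (1 + ε) * ‖x‖ + -‖x‖ := by
      rw [norm_smul, norm_inv, Real.norm_of_nonneg hε1.le]
      field_simp
      ring
    rw [h, Real.exp_add]
    gcongr
    linarith [Real.add_one_le_exp (ε / (1 + ε) * ‖x‖)]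
  · simp [indicator_of_notMem hx]

variable [BorelSpace E]

theorem measurable_expDensity (hS : IsClosed (S : Set E)) : Measurable (expDensity S) := by
  have : Measurable fun x : E => expConst S * ENNReal.ofReal (Real.exp (-‖x‖)) := by fun_prop
  exact this.indicator hS.measurableSet

/-- The expected norm of an exponentially distributed vector is at most the dimension. -/
theorem lintegral_norm_mul_expDensity_le [FiniteDimensional ℝ E]
    [(volume : Measure E).IsAddHaarMeasure] (hS : IsClosed (S : Set E))
    (h1 : ∫⁻ x, expDensity S x = 1) :
    ∫⁻ x, ENNReal.ofReal ‖x‖ * expDensity S x ≤ (Module.finrank ℝ E : ℝ≥0∞) := by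
  set n := Module.finrank ℝ E
  set A := ∫⁻ x, ENNReal.ofReal ‖x‖ * expDensity S x with hA
  have hm := measurable_expDensity hS
  -- Integrating `add_mul_expDensity_le` compares the mean norm with the Jacobian `(1 + ε) ^ n`; as
  -- `ε → 0` the difference quotient tends to `n`, with no polar coordinates needed.
  have hbound (ε : ℝ) (hε : 0 < ε) :
      A ≤ ENNReal.ofReal ((1 + ε) * (ε⁻¹ * ((1 + ε) ^ n - 1 ^ n))) := by
    have hε1 : 0 < 1 + ε := by linarith
    have hscale : ∫⁻ x, expDensity S ((1 + ε)⁻¹ • x) = ENNReal.ofReal ((1 + ε) ^ n) := by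
      have h := Measure.map_addHaar_smul (volume : Measure E) (inv_pos.2 hε1).ne'
      rw [← lintegral_map hm (measurable_const_smul _), h, lintegral_smul_measure, h1,
        smul_eq_mul, mul_one, inv_pow, inv_inv, abs_of_pos (by positivity)]
    have h2 : 1 + ENNReal.ofReal (ε / (1 + ε)) * A ≤ ENNReal.ofReal ((1 + ε) ^ n) := by
      rw [← hscale, hA, ← h1, ← lintegral_const_mul _ (by fun_prop), ← lintegral_add_left hm]
      exact lintegral_mono fun x => add_mul_expDensity_le hε x
    have h3 : ENNReal.ofReal (ε / (1 + ε)) * A ≤ ENNReal.ofReal ((1 + ε) ^ n - 1 ^ n) := by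
      rw [one_pow, ENNReal.ofReal_sub _ zero_le_one, ENNReal.ofReal_one]
      exact ENNReal.le_sub_of_add_le_left ENNReal.one_ne_top h2
    calc A = ENNReal.ofReal ((1 + ε) / ε) * (ENNReal.ofReal (ε / (1 + ε)) * A) := by
          rw [← mul_assoc, ← ENNReal.ofReal_mul (by positivity)]
          have : (1 + ε) / ε * (ε / (1 + ε)) = 1 := by field_simp
          rw [this, ENNReal.ofReal_one, one_mul]
      _ ≤ ENNReal.ofReal ((1 + ε) / ε) * ENNReal.ofReal ((1 + ε) ^ n - 1 ^ n) := by gcongr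
      _ = _ := by
          rw [← ENNReal.ofReal_mul (by positivity)]
          congr 1
          ring
  have hlim : Tendsto (fun ε : ℝ => (1 + ε) * (ε⁻¹ * ((1 + ε) ^ n - 1 ^ n))) (𝓝[>] 0)
      (𝓝 (n : ℝ)) := by
    have hd := (hasDerivAt_pow n (1 : ℝ)).tendsto_slope_zero_right
    have hc : Tendsto (fun ε : ℝ => 1 + ε) (𝓝[>] 0) (𝓝 (1 + 0)) :=
      ((continuous_const.add continuous_id).tendsto 0).mono_left nhdsWithin_le_nhds
    simpa using hc.mul hd
  have hlim' := ENNReal.tendsto_ofReal hlim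
  rw [ENNReal.ofReal_natCast] at hlim'
  refine ge_of_tendsto hlim' ?_
  filter_upwards [self_mem_nhdsWithin] with ε hε using hbound ε hε

end Density

/-! ### Crossings as parameter counts, and their measurability -/

section Crossings

variable {E : Type*} [NormedAddCommGroup E] [NormedSpace ℝ E]

theorem encard_biUnion_finset_le {ι α : Type*} (T : Finset ι) (A : ι → Set α) :
    (⋃ i ∈ T, A i).encard ≤ ∑ i ∈ T, (A i).encard := by
  classical
  induction T using Finset.induction_on with
  | empty => simp
  | insert i T hi ih =>
    rw [Finset.set_biUnion_insert, Finset.sum_insert hi]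
    exact (encard_union_le _ _).trans (by gcongr)

theorem crossings_le_sum_encard (T : Finset (PointedCone ℝ E)) {x y : E} {φ : ℝ → E}
    {Z : PointedCone ℝ E → Set ℝ}
    (h : ∀ C ∈ T, frontier (C : Set E) ∩ segment ℝ x y ⊆ φ '' Z C) :
    crossings T x y ≤ ∑ C ∈ T, ((Z C).encard : ℝ≥0∞) := by
  have h1 : (boundary T ∩ segment ℝ x y).encard ≤ ∑ C ∈ T, (Z C).encard := by
    rw [boundary, iUnion₂_inter]
    refine (encard_biUnion_finset_le T _).trans (Finset.sum_le_sum fun C hC => ?_)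
    exact (encard_le_encard (h C hC)).trans (encard_image_le _ _)
  unfold crossings
  calc ((boundary T ∩ segment ℝ x y).encard : ℝ≥0∞)
      ≤ ((∑ C ∈ T, (Z C).encard : ℕ∞) : ℝ≥0∞) := by exact_mod_cast h1
    _ = _ := map_sum ENat.toENNRealRingHom _ _

theorem isClosed_boundary (T : Finset (PointedCone ℝ E)) : IsClosed (boundary T) :=
  isClosed_biUnion_finset fun _ _ => isClosed_frontier

theorem crossings_eq_of_ne (T : Finset (PointedCone ℝ E)) {x y : E} (hxy : x ≠ y) :
    crossings T x y =
      (({s ∈ Icc (0 : ℝ) 1 | x + s • (y - x) ∈ boundary T} : Set ℝ).encard : ℝ≥0∞) := by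
  have hinj : Function.Injective fun s : ℝ => x + s • (y - x) :=
    (add_right_injective x).comp (smul_left_injective ℝ (sub_ne_zero.2 hxy.symm))
  rw [crossings, segment_eq_image', ← hinj.encard_image]
  congr 2
  ext z
  constructor
  · rintro ⟨h, s, hs, rfl⟩
    exact ⟨s, ⟨hs, h⟩, rfl⟩
  · rintro ⟨s, ⟨hs, h⟩, rfl⟩
    exact ⟨h, s, hs, rfl⟩

theorem crossings_self (T : Finset (PointedCone ℝ E)) (x : E) :
    crossings T x x = (boundary T).indicator 1 x := by
  rw [crossings, segment_same]
  by_cases hx : x ∈ boundary T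
  · rw [inter_singleton_of_mem hx]
    simp [hx]
  · rw [inter_singleton_of_notMem hx]
    simp [hx]

theorem measurable_crossings [FiniteDimensional ℝ E] [MeasurableSpace E] [BorelSpace E]
    (T : Finset (PointedCone ℝ E)) : Measurable fun q : E × E => crossings T q.1 q.2 := by
  classical
  have hproper : ProperSpace E := FiniteDimensional.proper ℝ E
  have hB := isClosed_boundary T
  have h1 : Measurable fun q : E × E => (boundary T).indicator (1 : E → ℝ≥0∞) q.1 :=
    (measurable_one.indicator hB.measurableSet).comp measurable_fst
  have h2 := measurable_encard_section 0 1
    (F := {p : ℝ × (E × E) | p.2.1 + p.1 • (p.2.2 - p.2.1) ∈ boundary T})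
    (hB.preimage (by fun_prop))
  have h3 : MeasurableSet {q : E × E | q.1 = q.2} :=
    (isClosed_eq continuous_fst continuous_snd).measurableSet
  -- The diagonal is separate: on a degenerate segment every parameter gives the same point, so
  -- counting parameters would overcount.
  convert Measurable.piecewise h3 h1 h2 using 1
  ext1 q
  by_cases hq : q.1 = q.2
  · rw [piecewise_eq_of_mem _ _ _ (show q ∈ {q : E × E | q.1 = q.2} from hq), ← hq,
      crossings_self]
  · rw [piecewise_eq_of_notMem _ _ _ (show q ∉ {q : E × E | q.1 = q.2} from hq)]
    exact crossings_eq_of_ne T hq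

theorem smul_mem_frontier {C : PointedCone ℝ E} {t : ℝ} (ht : 0 < t) {x : E}
    (hx : x ∈ frontier (C : Set E)) : t • x ∈ frontier (C : Set E) := by
  have hpre : (Homeomorph.smulOfNeZero (α := E) t ht.ne') ⁻¹' (C : Set E) = C := by
    ext y
    refine ⟨fun h => ?_, fun h => C.smul_mem ht.le h⟩
    have h' := C.smul_mem (inv_nonneg.2 ht.le) (show t • y ∈ C from h)
    rwa [inv_smul_smul₀ ht.ne'] at h'
  have h := (Homeomorph.smulOfNeZero (α := E) t ht.ne').preimage_frontier (C : Set E)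
  rw [hpre] at h
  rw [← h] at hx
  exact hx

theorem IsPartition.mem_support {T : Finset (PointedCone ℝ E)}
    {S : PointedCone ℝ E} (hT : IsPartition T S) {C : PointedCone ℝ E} (hC : C ∈ T) {x : E}
    (hx : x ∈ C) : x ∈ S := by
  change x ∈ (S : Set E)
  rw [← hT.support_eq]
  exact mem_biUnion hC hx

end Crossings

/-! ### From expectations to integrals against the density -/

theorem IsExpDistributed.lintegral_expDensity {E : Type*} [NormedAddCommGroup E]
    [NormedSpace ℝ E] [MeasureSpace E] {S : PointedCone ℝ E} {Ω : Type*} [MeasurableSpace Ω]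
    {P : Measure Ω} [IsProbabilityMeasure P] {X : Ω → E} (hX : IsExpDistributed P S X) :
    ∫⁻ x, expDensity S x = 1 := by
  have hlaw : HasLaw X (volume.withDensity (expDensity S)) P := hX
  have := hlaw.isProbabilityMeasure_iff.1 inferInstance
  rw [← setLIntegral_univ, ← withDensity_apply _ MeasurableSet.univ]
  exact measure_univ

theorem IsExpDistributed.aemeasurable_crossings_and_lintegral_le {E : Type*}
    [NormedAddCommGroup E] [NormedSpace ℝ E] [MeasureSpace E] [BorelSpace E]
    [FiniteDimensional ℝ E] {T : Finset (PointedCone ℝ E)} {S : PointedCone ℝ E}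
    {Ω : Type*} [MeasurableSpace Ω]
    {P : Measure Ω} {X : Ω → E} (hX : IsExpDistributed P S X) (hS : IsClosed (S : Set E))
    {f g : E → E} (hf : Measurable f) (hg : Measurable g) {B : ℝ≥0∞}
    (hB : ∫⁻ x, expDensity S x * crossings T (f x) (g x) ≤ B) :
    AEMeasurable (fun ω => crossings T (f (X ω)) (g (X ω))) P ∧
      ∫⁻ ω, crossings T (f (X ω)) (g (X ω)) ∂P ≤ B := by
  have hlaw : HasLaw X (volume.withDensity (expDensity S)) P := hX
  have hfg : Measurable fun x => crossings T (f x) (g x) :=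
    Measurable.comp (g := fun q : E × E => crossings T q.1 q.2) (f := fun x => (f x, g x))
      (measurable_crossings T) (hf.prodMk hg)
  refine ⟨hfg.comp_aemeasurable hlaw.aemeasurable, ?_⟩
  rw [hlaw.lintegral_comp hfg.aemeasurable]
  exact (lintegral_withDensity_eq_lintegral_mul _ (measurable_expDensity hS) hfg).trans_le hB

/-! ### Summation over the cones and the two bounds -/

section Bounds

variable {E : Type*} [NormedAddCommGroup E] [NormedSpace ℝ E] [MeasureSpace E] [BorelSpace E]
  [FiniteDimensional ℝ E] [(volume : Measure E).IsAddHaarMeasure]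
  {T : Finset (PointedCone ℝ E)} {S : PointedCone ℝ E} {τ : ℝ}

theorem IsPartition.lintegral_sum_encard_mul_le (hT : IsPartition T S) (hτ : 0 < τ)
    (hwide : ∀ C ∈ T, IsWide τ C) {a b : ℝ} {p v : E} {κ : ℝ → ℝ} {k : E → ℝ}
    (hκm : Measurable κ) (hkm : Measurable k) (hκ : ∀ s ∈ Icc a b, 0 ≤ κ s) (hk : ∀ y, 0 ≤ k y)
    (hloc : ∀ (C : PointedCone ℝ E) (u : E) (H : E → ℝ),
      Metric.closedBall u τ ⊆ (C : Set E) → (∀ x r, x + r • u ∈ C ↔ H x ≤ r) →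
      ∀ s ∈ Icc a b, ∀ q, H (q + (p + s • v)) = 0 →
        ∀ᶠ s' in 𝓝 s, |H (q + (p + s' • v))| ≤ κ s * k q * |s' - s|)
    {w W : E → ℝ≥0∞} (hw : Measurable w) (hW : Measurable W)
    (hwW : ∀ u ∈ S, ‖u‖ = 1 → ∀ y,
      ENNReal.ofReal (k y) * w y ≤ ∫⁻ t in Ioi (0 : ℝ), W (y + t • u)) :
    ∫⁻ x, w x * ∑ C ∈ T,
        (({s ∈ Icc a b | x + (p + s • v) ∈ frontier (C : Set E)} : Set ℝ).encard : ℝ≥0∞) ≤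
      (∫⁻ s in Icc a b, ENNReal.ofReal (κ s)) * ∫⁻ x, W x := by
  have hproper : ProperSpace E := FiniteDimensional.proper ℝ E
  have hcone : ∀ C ∈ T,
      ∫⁻ x, (({s ∈ Icc a b | x + (p + s • v) ∈ frontier (C : Set E)} : Set ℝ).encard : ℝ≥0∞) *
          w x ≤
        ∫⁻ s in Icc a b, ENNReal.ofReal (κ s) *
          ∫⁻ x, (C : Set E).indicator 1 (x + (p + s • v)) * W x := by
    intro C hC
    obtain ⟨u, hu1, hu⟩ := hwide C hC
    have hCc := hT.isClosed_of_mem C hC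
    -- The whole space has no height function, but its frontier is empty.
    by_cases huniv : (C : Set E) = univ
    · simp [huniv]
    obtain ⟨H, hH⟩ := exists_height hCc hτ hu huniv
    have hHc := (lipschitzWith_height hH hτ hu).continuous
    have huS := hT.mem_support hC (hu (Metric.mem_closedBall_self hτ.le))
    refine le_trans (lintegral_mono fun x => ?_) (lintegral_encard_height_zeros_mul_le volume hCc
      (norm_ne_zero_iff.1 (by rw [hu1]; exact one_ne_zero)) hτ hu hH hκm hkm hκ hk
      (hloc C u H hu hH) hw hW (hwW u huS hu1))
    gcongr
    exact fun h => height_eq_zero_of_mem_frontier hH hHc hCc h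
  have hN (C : PointedCone ℝ E) : Measurable fun x : E =>
      (({s ∈ Icc a b | x + (p + s • v) ∈ frontier (C : Set E)} : Set ℝ).encard : ℝ≥0∞) :=
    measurable_encard_section a b (F := {q : ℝ × E | q.2 + (p + q.1 • v) ∈ frontier (C : Set E)})
      (isClosed_frontier.preimage (by fun_prop))
  have hD : ∀ C ∈ T, Measurable fun s : ℝ => ENNReal.ofReal (κ s) *
      ∫⁻ x, (C : Set E).indicator 1 (x + (p + s • v)) * W x := by
    intro C hC
    refine hκm.ennreal_ofReal.mul ?_
    refine Measurable.lintegral_prod_right' (f := fun q : ℝ × E =>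
      (C : Set E).indicator 1 (q.2 + (p + q.1 • v)) * W q.2) ?_
    exact ((measurable_one.indicator (hT.isClosed_of_mem C hC).measurableSet).comp
      (by fun_prop)).mul (hW.comp measurable_snd)
  calc ∫⁻ x, w x * ∑ C ∈ T,
        (({s ∈ Icc a b | x + (p + s • v) ∈ frontier (C : Set E)} : Set ℝ).encard : ℝ≥0∞)
      = ∑ C ∈ T, ∫⁻ x,
          (({s ∈ Icc a b | x + (p + s • v) ∈ frontier (C : Set E)} : Set ℝ).encard : ℝ≥0∞) *
            w x := by
        have hNw (C : PointedCone ℝ E) : Measurable fun x : E =>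
            (({s ∈ Icc a b | x + (p + s • v) ∈ frontier (C : Set E)} : Set ℝ).encard : ℝ≥0∞) *
              w x := (hN C).mul hw
        rw [← lintegral_finsetSum _ fun C _ => hNw C]
        refine lintegral_congr fun x => ?_
        rw [mul_comm, Finset.sum_mul]
    _ ≤ ∑ C ∈ T, ∫⁻ s in Icc a b, ENNReal.ofReal (κ s) *
          ∫⁻ x, (C : Set E).indicator 1 (x + (p + s • v)) * W x := Finset.sum_le_sum hcone
    _ = ∫⁻ s in Icc a b, ENNReal.ofReal (κ s) *
          ∑ C ∈ T, ∫⁻ x, (C : Set E).indicator 1 (x + (p + s • v)) * W x := by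
        rw [← lintegral_finsetSum _ hD]
        simp only [Finset.mul_sum]
    _ ≤ ∫⁻ s in Icc a b, ENNReal.ofReal (κ s) * ∫⁻ x, W x := by
        gcongr with s
        exact hT.sum_lintegral_indicator_mul_le volume _ hW
    _ = _ := lintegral_mul_const _ hκm.ennreal_ofReal

theorem IsPartition.lintegral_expDensity_mul_crossings_translate_le (hT : IsPartition T S)
    (hτ : 0 < τ) (hwide : ∀ C ∈ T, IsWide τ C) (h1 : ∫⁻ x, expDensity S x = 1) (c d : E) :
    ∫⁻ x, expDensity S x * crossings T (c + x) (d + x) ≤ ENNReal.ofReal (‖d - c‖ / τ) := by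
  have hm := measurable_expDensity hT.isClosed_support
  have hcross (x : E) : crossings T (c + x) (d + x) ≤ ∑ C ∈ T, (({s ∈ Icc (0 : ℝ) 1 |
      x + (c + s • (d - c)) ∈ frontier (C : Set E)} : Set ℝ).encard : ℝ≥0∞) := by
    refine crossings_le_sum_encard T (φ := fun s => x + (c + s • (d - c))) fun C _ => ?_
    rw [segment_eq_image']
    rintro _ ⟨hz, s, hs, rfl⟩
    have heq : c + x + s • (d + x - (c + x)) = x + (c + s • (d - c)) := by
      rw [add_sub_add_right_eq_sub]; abel
    simp only [heq] at hz ⊢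
    exact ⟨s, ⟨hs, hz⟩, rfl⟩
  calc ∫⁻ x, expDensity S x * crossings T (c + x) (d + x)
      ≤ ∫⁻ x, expDensity S x * ∑ C ∈ T, (({s ∈ Icc (0 : ℝ) 1 |
          x + (c + s • (d - c)) ∈ frontier (C : Set E)} : Set ℝ).encard : ℝ≥0∞) := by
        gcongr with x
        exact hcross x
    _ ≤ (∫⁻ s in Icc (0 : ℝ) 1, ENNReal.ofReal 1) *
          ∫⁻ x, ENNReal.ofReal (‖d - c‖ / τ) * expDensity S x := by
        refine hT.lintegral_sum_encard_mul_le hτ hwide (κ := fun _ => 1)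
          (k := fun _ => ‖d - c‖ / τ) measurable_const measurable_const
          (fun _ _ => zero_le_one) (fun _ => by positivity) ?_ hm (hm.const_mul _) ?_
        · intro C u H hu hH s _ q hq
          refine Eventually.of_forall fun s' => ?_
          have h := abs_height_sub_le hH hτ hu (q + (c + s' • (d - c))) (q + (c + s • (d - c)))
          rw [hq, sub_zero, add_sub_add_left_eq_sub, add_sub_add_left_eq_sub, ← sub_smul,
            norm_smul, Real.norm_eq_abs] at h
          refine h.trans_eq ?_
          ring
        · intro u hu hu1 y
          rw [lintegral_const_mul' _ _ ENNReal.ofReal_ne_top]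
          gcongr
          exact expDensity_le_lintegral hu hu1 y
    _ = ENNReal.ofReal (‖d - c‖ / τ) := by
        rw [lintegral_const_mul _ hm, h1]
        simp

theorem IsPartition.lintegral_expDensity_mul_crossings_dilate_le (hT : IsPartition T S)
    (hτ : 0 < τ) (hwide : ∀ C ∈ T, IsWide τ C) (h1 : ∫⁻ x, expDensity S x = 1) (c : E)
    {α : ℝ} (hα0 : 0 < α) (hα1 : α < 1) :
    ∫⁻ x, expDensity S x * crossings T (c + α • x) (c + x) ≤
      ENNReal.ofReal (2 * Module.finrank ℝ E / τ * Real.log (1 / α)) := by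
  have hm := measurable_expDensity hT.isClosed_support
  have hα : 1 ≤ 1 / α := (one_le_div hα0).2 hα1.le
  have hcross (x : E) : crossings T (c + α • x) (c + x) ≤ ∑ C ∈ T, (({s ∈ Icc (1 : ℝ) (1 / α) |
      x + (0 + s • c) ∈ frontier (C : Set E)} : Set ℝ).encard : ℝ≥0∞) := by
    -- The frontier of a cone is invariant under positive scaling, so `c + t • x` may be replaced by
    -- `x + t⁻¹ • c`, a path affine in `s = t⁻¹` with `x` moved only by translation.
    refine crossings_le_sum_encard T (φ := fun s => c + s⁻¹ • x) fun C _ => ?_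
    rw [segment_eq_image']
    rintro _ ⟨hz, θ, ⟨hθ0, hθ1⟩, rfl⟩
    have heq : c + α • x + θ • (c + x - (c + α • x)) = c + (α + θ * (1 - α)) • x := by
      match_scalars <;> ring
    simp only [heq] at hz ⊢
    set t := α + θ * (1 - α)
    have htα : α ≤ t := le_add_of_nonneg_right (mul_nonneg hθ0 (by linarith))
    have ht1 : t ≤ 1 := by
      have := mul_le_mul_of_nonneg_right hθ1 (show 0 ≤ 1 - α by linarith)
      simp only [t]
      linarith
    have ht0 : 0 < t := hα0.trans_le htα
    refine ⟨t⁻¹, ⟨⟨(one_le_inv₀ ht0).2 ht1, ?_⟩, ?_⟩, by simp⟩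
    · rw [one_div]
      exact inv_anti₀ hα0 htα
    · have h := smul_mem_frontier (inv_pos.2 ht0) hz
      rwa [smul_add, inv_smul_smul₀ ht0.ne', add_comm, ← zero_add (t⁻¹ • c)] at h
  have hlog : ∫⁻ s in Icc (1 : ℝ) (1 / α), ENNReal.ofReal s⁻¹ =
      ENNReal.ofReal (Real.log (1 / α)) := by
    have hpos : ∀ᵐ s ∂(volume.restrict (Ioc (1 : ℝ) (1 / α))), 0 ≤ s⁻¹ :=
      (ae_restrict_iff' measurableSet_Ioc).2 (Eventually.of_forall fun s hs =>
        inv_nonneg.2 (zero_le_one.trans hs.1.le))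
    have hint : IntervalIntegrable (fun s : ℝ => s⁻¹) volume 1 (1 / α) :=
      intervalIntegral.intervalIntegrable_inv (fun s hs => by
        rw [uIcc_of_le hα] at hs
        exact (zero_lt_one.trans_le hs.1).ne') continuousOn_id
    rw [setLIntegral_congr Ioc_ae_eq_Icc.symm,
      ← ofReal_integral_eq_lintegral_ofReal hint.1 hpos, ← intervalIntegral.integral_of_le hα,
      integral_inv_of_pos zero_lt_one (by positivity), div_one]
  have hmn : Measurable fun x : E => ENNReal.ofReal ‖x‖ * expDensity S x := by fun_prop
  calc ∫⁻ x, expDensity S x * crossings T (c + α • x) (c + x)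
      ≤ ∫⁻ x, expDensity S x * ∑ C ∈ T, (({s ∈ Icc (1 : ℝ) (1 / α) |
          x + (0 + s • c) ∈ frontier (C : Set E)} : Set ℝ).encard : ℝ≥0∞) := by
        gcongr with x
        exact hcross x
    _ ≤ (∫⁻ s in Icc (1 : ℝ) (1 / α), ENNReal.ofReal s⁻¹) *
          ∫⁻ x, ENNReal.ofReal (2 / τ) * (ENNReal.ofReal ‖x‖ * expDensity S x) := by
        refine hT.lintegral_sum_encard_mul_le hτ hwide (κ := fun s => s⁻¹)
          (k := fun q => ‖q‖ / τ) measurable_inv (by fun_prop)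
          (fun s hs => inv_nonneg.2 (zero_le_one.trans hs.1)) (fun _ => by positivity) ?_ hm
          (hmn.const_mul _) ?_
        · intro C u H hu hH s hs q hq
          have hs0 : 0 < s := zero_lt_one.trans_le hs.1
          filter_upwards [eventually_gt_nhds hs0] with s' hs'
          have hratio : 0 < s' / s := div_pos hs' hs0
          -- Comparing with this rescaled zero cancels the `c` component, so the slope involves `‖q‖
          -- / s` only.
          have h0 : H ((s' / s) • (q + (0 + s • c))) = 0 := by
            rw [height_smul hH hratio, hq, mul_zero]
          have h := abs_height_sub_le hH hτ hu (q + (0 + s' • c)) ((s' / s) • (q + (0 + s • c)))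
          have hdiff : q + (0 + s' • c) - (s' / s) • (q + (0 + s • c)) =
              (-(s⁻¹ * (s' - s))) • q := by
            match_scalars <;> field_simp <;> ring
          rw [h0, sub_zero, hdiff, norm_smul, Real.norm_eq_abs, abs_neg, abs_mul,
            abs_of_pos (inv_pos.2 hs0)] at h
          refine h.trans_eq ?_
          ring
        · intro u hu hu1 y
          rw [lintegral_const_mul' _ _ ENNReal.ofReal_ne_top, div_eq_mul_inv ‖y‖, mul_comm ‖y‖,
            ENNReal.ofReal_mul (inv_nonneg.2 hτ.le), div_eq_mul_inv 2 τ, mul_comm (2 : ℝ),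
            ENNReal.ofReal_mul (inv_nonneg.2 hτ.le), mul_assoc, mul_assoc, ENNReal.ofReal_ofNat]
          gcongr ENNReal.ofReal τ⁻¹ * ?_
          exact norm_mul_expDensity_le_lintegral hu hu1 y
    _ ≤ ENNReal.ofReal (Real.log (1 / α)) *
          (ENNReal.ofReal (2 / τ) * (Module.finrank ℝ E : ℝ≥0∞)) := by
        rw [hlog, lintegral_const_mul _ hmn]
        gcongr
        exact lintegral_norm_mul_expDensity_le hT.isClosed_support h1
    _ = ENNReal.ofReal (2 * Module.finrank ℝ E / τ * Real.log (1 / α)) := by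
        rw [← ENNReal.ofReal_natCast, ← ENNReal.ofReal_mul (by positivity),
          ← ENNReal.ofReal_mul (Real.log_nonneg hα)]
        congr 1
        ring

end Bounds

end ConePartition

theorem theorem5 {n : ℕ} {τ : ℝ} (hτ : 0 < τ)
    (T : Finset (PointedCone ℝ (EuclideanSpace ℝ (Fin n))))
    (S : PointedCone ℝ (EuclideanSpace ℝ (Fin n)))
    (hT : ConePartition.IsPartition T S)
    (hpoly : ∀ C ∈ T, ConePartition.IsPolyhedral C)
    (hwide : ∀ C ∈ T, ConePartition.IsWide τ C)
    {Ω : Type*} [MeasurableSpace Ω] (P : Measure Ω) [IsProbabilityMeasure P]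
    (X : Ω → EuclideanSpace ℝ (Fin n)) (hX : ConePartition.IsExpDistributed P S X)
    (c d : EuclideanSpace ℝ (Fin n)) :
    (AEMeasurable (fun ω => ConePartition.crossings T (c + X ω) (d + X ω)) P ∧
      ∫⁻ ω, ConePartition.crossings T (c + X ω) (d + X ω) ∂P ≤ ENNReal.ofReal (‖d - c‖ / τ)) ∧
    ∀ α : ℝ, 0 < α → α < 1 →
      AEMeasurable (fun ω => ConePartition.crossings T (c + α • X ω) (c + X ω)) P ∧
      ∫⁻ ω, ConePartition.crossings T (c + α • X ω) (c + X ω) ∂P ≤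
        ENNReal.ofReal (2 * n / τ * Real.log (1 / α)) := by
  have h1 := hX.lintegral_expDensity
  refine ⟨hX.aemeasurable_crossings_and_lintegral_le hT.isClosed_support
    (measurable_const_add c) (measurable_const_add d)
    (hT.lintegral_expDensity_mul_crossings_translate_le hτ hwide h1 c d), fun α hα0 hα1 =>
    hX.aemeasurable_crossings_and_lintegral_le hT.isClosed_support
      ((measurable_const_smul α).const_add c) (measurable_const_add c) ?_⟩
  have h := hT.lintegral_expDensity_mul_crossings_dilate_le hτ hwide h1 c hα0 hα1
  rwa [finrank_euclideanSpace_fin] at h
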